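/- Let $A$ be an alphabet and let $1$ be the empty word of $A^*$. For a word $w\in A^*$ let $w^{(+)}$ be the shortest palindrome having $w$ as a prefix, and let $\mathrm{Pal}\colon A^*\to A^*$ be the iterated palindromic closure, defined by $\mathrm{Pal}(1)=1$ and $\mathrm{Pal}(wa)=(\mathrm{Pal}(w)a)^{(+)}$ for $w\in A^*$, $a\in A$. A compact automaton consists of a set $Q$ of states, a set $E\subset Q\times A^+\times Q$ of edges, and sets $I,T\subset Q$ of initial and terminal states. For a language $L\subset A^*$, a nonempty residual $u^{-1}L=\{v\in A^*\mid uv\in L\}$ is called special if $u=1$, or $u\in L$, or two words of $u^{-1}L$ begin with different letters. The minimal compact automaton of $L$ has as states the special residuals of $L$; its initial state is $L$; its terminal states are the $u^{-1}L$ with $u\in L$; its edges are the triples $(u^{-1}L,\,v,\,(uv)^{-1}L)$ between states, with $v\neq 1$, such that there is no factorization $v=v'v''$ with $v',v''$ nonempty and $(uv')^{-1}L$ special. For $u\in A^*$ let $\mathcal S_c(u)$ be the minimal compact automaton of the language $L_u$ of all suffixes of $\mathrm{Pal}(u)$. The map $p\mapsto \mathrm{Pal}(p)^{-1}L_u$ is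 a bijection from the set of prefixes $p$ of $u$ onto the set of states of $\mathcal S_c(u)$; by means of it, we regard the prefixes of $u$ as the states of $\mathcal S_c(u)$. **Proposition.** Let $u\in A^*$ and $x\in A$. Write $u=hu_2$, where $u_2$ is the longest suffix of $u$ in which the letter $x$ does not occur. Construct a compact automaton $\mathcal S$ from $\mathcal S_c(u)$ as follows: - add to $\mathcal S_c(u)$ the new state $ux$, which is terminal (the states, edges, initial state and terminal states of $\mathcal S_c(u)$ are kept); - for each prefix $p$ of $u_2$ (including $p=1$ and $p=u_2$), add an edge from the state $hp$ to the new state $ux$, labelled $\mathrm{Pal}(u)^{-1}\mathrm{Pal}(ux)$, that is, the word $s$ such that $\mathrm{Pal}(u)s=\mathrm{Pal}(ux)$. Then $\mathcal S=\mathcal S_c(ux)$, as compact automata whose states are the prefixes of $ux$. -/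

import Mathlib

/-! ### Iterated palindromic closure -/

/-- The palindromic closure `w⁽⁺⁾ = y z ỹ`, where `w = y z` and `z` is the longest palindromic
suffix of `w`: letters are peeled off the front of `w` until a palindrome is left. It is the
unique shortest palindrome having `w` as a prefix, see `palClosure_spec`. -/
def palClosure {A : Type*} [DecidableEq A] : List A → List A
  | [] => []
  | a :: w => if (a :: w).reverse = a :: w then a :: w else a :: (palClosure w ++ [a])

theorem prefix_palClosure {A : Type*} [DecidableEq A] (w : List A) : w <+: palClosure w := by
  induction w with
  | nil => simp [palClosure]
  | cons a w ih =>
    unfold palClosure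
    split
    · exact List.prefix_rfl
    · exact List.cons_prefix_cons.2 ⟨rfl, ih.trans (List.prefix_append _ _)⟩

theorem reverse_palClosure {A : Type*} [DecidableEq A] (w : List A) :
    (palClosure w).reverse = palClosure w := by
  induction w with
  | nil => simp [palClosure]
  | cons a w ih =>
    unfold palClosure
    split
    · assumption
    · simp [ih]

/-- Every palindrome having `w` as a prefix is longer than the palindromic closure of `w`, or
equal to it. -/
theorem palClosure_shortest {A : Type*} [DecidableEq A] (w t : List A)
    (ht : t.reverse = t) (hw : w <+: t) :
    t = palClosure w ∨ (palClosure w).length < t.length := by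
  induction w generalizing t with
  | nil => cases t <;> simp [palClosure]
  | cons a w ih =>
    unfold palClosure
    split
    · obtain ⟨s, rfl⟩ := hw
      cases s <;> simp
    · rename_i hne
      obtain ⟨s, rfl⟩ := hw
      rcases List.eq_nil_or_concat s with rfl | ⟨r, b, rfl⟩
      · exact absurd (by simpa using ht) hne
      · have h1 : (a :: w ++ (r ++ [b])) = a :: ((w ++ r) ++ [b]) := by simp
        rw [List.concat_eq_append, h1] at ht ⊢
        have h2 : b :: ((w ++ r).reverse ++ [a]) = a :: ((w ++ r) ++ [b]) := by
          simpa using ht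
        obtain ⟨rfl, h3⟩ := List.cons.inj h2
        have h4 : (w ++ r).reverse = w ++ r := List.append_cancel_right h3
        rcases ih (w ++ r) h4 (List.prefix_append _ _) with h5 | h5
        · left; rw [h5]
        · right; simp at h5 ⊢; omega

/-- The palindromic closure of `w` is the unique shortest palindrome with prefix `w`. -/
theorem palClosure_spec {A : Type*} [DecidableEq A] (w t : List A) :
    t = palClosure w ↔ (t.reverse = t ∧ w <+: t ∧
      ∀ s : List A, s.reverse = s → w <+: s → t.length ≤ s.length) := by
  constructor
  · rintro rfl
    refine ⟨reverse_palClosure w, prefix_palClosure w, fun s hs hws => ?_⟩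
    rcases palClosure_shortest w s hs hws with h | h
    · rw [h]
    · exact h.le
  · rintro ⟨h1, h2, h3⟩
    rcases palClosure_shortest w t h1 h2 with h | h
    · exact h
    · exact absurd (h3 _ (reverse_palClosure w) (prefix_palClosure w)) (not_le.2 h)

/-- The iterated palindromic closure: `Pal(1) = 1` and `Pal(wa) = (Pal(w) a)⁽⁺⁾`. -/
def Pal {A : Type*} [DecidableEq A] (w : List A) : List A :=
  w.foldl (fun v a => palClosure (v ++ [a])) []

theorem Pal_nil {A : Type*} [DecidableEq A] : Pal ([] : List A) = [] := rfl

theorem Pal_append_singleton {A : Type*} [DecidableEq A] (w : List A) (a : A) :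
    Pal (w ++ [a]) = palClosure (Pal w ++ [a]) := by
  simp [Pal]

/-- For words `v`, `w` such that `v` is a prefix of `w`, the word `v⁻¹ w`, that is, the word `s`
with `v s = w`. -/
def wordQuotient {A : Type*} (v w : List A) : List A := w.drop v.length

/-- The word `Pal(u)⁻¹ Pal(ux)` is well defined and nonempty. -/
theorem Pal_append_wordQuotient {A : Type*} [DecidableEq A] (u : List A) (x : A) :
    Pal u ++ wordQuotient (Pal u) (Pal (u ++ [x])) = Pal (u ++ [x]) ∧
      wordQuotient (Pal u) (Pal (u ++ [x])) ≠ [] := by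
  rw [Pal_append_singleton]
  obtain ⟨s, hs⟩ := prefix_palClosure (Pal u ++ [x])
  rw [← hs]
  simp [wordQuotient]

/-! ### Compact automata -/

/-- A compact automaton `(Q, E, I, T)` over the alphabet `A`: a set of states `Q` (a subset of the
type `σ`), a set of edges `E ⊆ Q × A⁺ × Q`, and sets `I, T ⊆ Q` of initial and of terminal
states. -/
@[ext]
structure CompactAutomaton (A : Type*) (σ : Type*) where
  states : Set σ
  edges : Set (σ × List A × σ)
  initial : Set σ
  terminal : Set σ
  edges_mem : ∀ p v q, (p, v, q) ∈ edges → p ∈ states ∧ v ≠ [] ∧ q ∈ states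
  initial_subset : initial ⊆ states
  terminal_subset : terminal ⊆ states

/-- The map `f` is an isomorphism from the compact automaton `M` onto the compact automaton `N`. -/
def CompactAutomaton.IsIso {A σ τ : Type*} (f : σ → τ) (M : CompactAutomaton A σ)
    (N : CompactAutomaton A τ) : Prop :=
  Set.BijOn f M.states N.states ∧
  (∀ p ∈ M.states, ∀ q ∈ M.states, ∀ v, (p, v, q) ∈ M.edges ↔ (f p, v, f q) ∈ N.edges) ∧
  (∀ p ∈ M.states, p ∈ M.initial ↔ f p ∈ N.initial) ∧
  (∀ p ∈ M.states, p ∈ M.terminal ↔ f p ∈ N.terminal)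

/-- Renaming of states: the compact automaton with set of states `S`, in which the name `p ∈ S`
stands for the state `f p` of `N`. -/
def CompactAutomaton.rename {A σ τ : Type*} (N : CompactAutomaton A τ) (S : Set σ) (f : σ → τ) :
    CompactAutomaton A σ where
  states := S
  edges := {e | e.1 ∈ S ∧ e.2.2 ∈ S ∧ (f e.1, e.2.1, f e.2.2) ∈ N.edges}
  initial := {p | p ∈ S ∧ f p ∈ N.initial}
  terminal := {p | p ∈ S ∧ f p ∈ N.terminal}
  edges_mem := fun _ _ _ h => ⟨h.1, (N.edges_mem _ _ _ h.2.2).2.1, h.2.1⟩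
  initial_subset := fun _ h => h.1
  terminal_subset := fun _ h => h.1

/-- `R` is a special residual of the language `L`: a nonempty residual `R = u⁻¹L` such that
`u = 1`, or `u ∈ L`, or two words of `R` begin with different letters. Here
`L.leftQuotient u = {v | u ++ v ∈ L}`. -/
def IsSpecialResidual {A : Type*} (L R : Language A) : Prop :=
  (∃ v, v ∈ R) ∧ ∃ u : List A, R = L.leftQuotient u ∧
    (u = [] ∨ u ∈ L ∨ ∃ (a b : A) (v w : List A), a ≠ b ∧ a :: v ∈ R ∧ b :: w ∈ R)

/-- The minimal compact automaton of a language `L`. Its states are the special residuals of `L`.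
The initial state is `L`; the terminal states are the `u⁻¹L` with `u ∈ L`. The edges are the
triples `(u⁻¹L, v, (uv)⁻¹L)` with `v` nonempty such that no factorization `v = v'v''` into
nonempty words has `(uv')⁻¹L` special. -/
def minimalCompactAutomaton {A : Type*} (L : Language A) : CompactAutomaton A (Language A) where
  states := {R | IsSpecialResidual L R}
  edges := {e | IsSpecialResidual L e.1 ∧ e.2.1 ≠ [] ∧ IsSpecialResidual L e.2.2 ∧
    ∃ u : List A, e.1 = L.leftQuotient u ∧ e.2.2 = L.leftQuotient (u ++ e.2.1) ∧
      ¬ ∃ v₁ v₂ : List A, e.2.1 = v₁ ++ v₂ ∧ v₁ ≠ [] ∧ v₂ ≠ [] ∧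
        IsSpecialResidual L (L.leftQuotient (u ++ v₁))}
  initial := {R | IsSpecialResidual L R ∧ R = L}
  terminal := {R | IsSpecialResidual L R ∧ ∃ u ∈ L, R = L.leftQuotient u}
  edges_mem := fun _ _ _ h => ⟨h.1, h.2.1, h.2.2.1⟩
  initial_subset := fun _ h => h.1
  terminal_subset := fun _ h => h.1

/-! ### The compact suffix automaton of `Pal(u)` -/

/-- The language of all suffixes of the word `w`. -/
def suffixLanguage {A : Type*} (w : List A) : Language A := {s | s <:+ w}

/-- `𝒮_c(u)`: the minimal compact automaton of the set of suffixes of `Pal(u)`. -/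
def compactSuffixAutomaton {A : Type*} [DecidableEq A] (u : List A) :
    CompactAutomaton A (Language A) :=
  minimalCompactAutomaton (suffixLanguage (Pal u))

/-- The residual `Pal(p)⁻¹L` of the language `L` of suffixes of `Pal(u)`, with which the prefix
`p` of `u` is identified. -/
def prefixToState {A : Type*} [DecidableEq A] (u p : List A) : Language A :=
  (suffixLanguage (Pal u)).leftQuotient (Pal p)

/-- `𝒮_c(u)` with its states renamed as prefixes of `u`, the prefix `p` of `u` standing for the
state `Pal(p)⁻¹L`, where `L` is the language of suffixes of `Pal(u)`. -/
def prefixSuffixAutomaton {A : Type*} [DecidableEq A] (u : List A) :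
    CompactAutomaton A (List A) :=
  (compactSuffixAutomaton u).rename {p | p <+: u} (prefixToState u)

/-- The new state `ux` is not a state of `𝒮_c(u)`. -/
theorem notMem_states_prefixSuffixAutomaton {A : Type*} [DecidableEq A] (u : List A) (x : A) :
    u ++ [x] ∉ (prefixSuffixAutomaton u).states := by
  intro h
  have h1 : u ++ [x] <+: u := h
  simpa using h1.length_le

/-- The automaton constructed from `𝒮_c(u)`, where `u = h u₂`, by adding a new terminal state `ux`
and, for each prefix `p` of `u₂`, an edge from `hp` to `ux` labelled `Pal(u)⁻¹ Pal(ux)`. -/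
def extendedAutomaton {A : Type*} [DecidableEq A] (u : List A) (x : A) (h u₂ : List A)
    (hu : u = h ++ u₂) : CompactAutomaton A (List A) where
  states := (prefixSuffixAutomaton u).states ∪ {u ++ [x]}
  edges := (prefixSuffixAutomaton u).edges ∪
    {e | ∃ p, p <+: u₂ ∧ e = (h ++ p, wordQuotient (Pal u) (Pal (u ++ [x])), u ++ [x])}
  initial := (prefixSuffixAutomaton u).initial
  terminal := (prefixSuffixAutomaton u).terminal ∪ {u ++ [x]}
  edges_mem := by
    rintro p v q (he | ⟨r, hr, he⟩)
    · obtain ⟨h1, h2, h3⟩ := (prefixSuffixAutomaton u).edges_mem p v q he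
      exact ⟨Or.inl h1, h2, Or.inl h3⟩
    · simp only [Prod.mk.injEq] at he
      obtain ⟨rfl, rfl, rfl⟩ := he
      refine ⟨Or.inl ?_, (Pal_append_wordQuotient u x).2, Or.inr rfl⟩
      change h ++ r <+: u
      rw [hu]
      exact (List.prefix_append_right_inj h).2 hr
  initial_subset := fun _ hp => Or.inl ((prefixSuffixAutomaton u).initial_subset hp)
  terminal_subset := Set.union_subset_union_left _ (prefixSuffixAutomaton u).terminal_subset

/-! The edges of 𝒮_c(u) have an explicit form (`mem_edges_prefixSuffixAutomaton`): they join p to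
pta, a prefix of u with a ∉ t, with label Pal(pt)⁻¹Pal(pta). Here u only bounds the target. Passing
to ux thus adds just the edges into ux, which start at the p with u = pt and x ∉ t, that is, p = hq
with q a prefix of u₂.

The facts about Pal come from Justin's formula `Pal_cons` by desubstitution: palindromic prefixes of
Pal(u) are the Pal(p), left special factors are prefixes, and Pal(p)a occurs in Pal(pv) only if a
occurs in v. Hence every factor extends to the left to a prefix with the same residual. If the
residual is special, reversal makes this prefix a palindrome, so some Pal(p)
(`isSpecialResidual_iff`). If a ∉ t, then Pal(p)a extends in this way to Pal(pt)a
(`leftQuotient_Pal_append`), so reading from p follows Pal(u) from Pal(pt) until the next state,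
pta. -/

/-! ### The morphism `c ↦ c`, `a ↦ ca` and Justin's formula -/

/-- The endomorphism of the free monoid with `c ↦ c` and `a ↦ ca` for `a ≠ c`. -/
def psi {A : Type*} [DecidableEq A] (c : A) (w : List A) : List A :=
  w.flatMap fun a => if a = c then [c] else [c, a]

section Psi

variable {A : Type*} [DecidableEq A] {c : A}

@[simp] theorem psi_nil : psi c [] = [] := rfl

@[simp] theorem psi_cons_self (w : List A) : psi c (c :: w) = c :: psi c w := by simp [psi]

theorem psi_cons_of_ne {a : A} (h : a ≠ c) (w : List A) :
    psi c (a :: w) = c :: a :: psi c w := by simp [psi, h]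

@[simp] theorem psi_append (v w : List A) : psi c (v ++ w) = psi c v ++ psi c w := by
  simp [psi]

theorem psi_singleton_of_ne {a : A} (h : a ≠ c) : psi c [a] = [c, a] := by simp [psi, h]

/-- The image of a word under `psi c`, followed by `c`, starts with `c`. -/
theorem exists_psi_append_eq_cons (w : List A) : ∃ t, psi c w ++ [c] = c :: t := by
  cases w with
  | nil => exact ⟨[], rfl⟩
  | cons a w =>
    by_cases h : a = c
    · subst h; exact ⟨_, by rw [psi_cons_self, List.cons_append]⟩
    · exact ⟨_, by rw [psi_cons_of_ne h, List.cons_append]⟩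

/-- For each letter a, `psi c [a]` followed by c is c followed by the reversal of `psi c [a]`; the
final c can thus be moved through the word. -/
theorem reverse_psi_append (w : List A) :
    (psi c w ++ [c]).reverse = psi c w.reverse ++ [c] := by
  induction w with
  | nil => rfl
  | cons a w ih =>
    simp only [List.reverse_append, List.reverse_cons, List.reverse_nil, List.nil_append,
      List.singleton_append] at ih
    by_cases h : a = c
    · subst h; simp [ih]
    · simp [psi_cons_of_ne h, ih]

/-- The letter after a leading c tells the image of c from that of another letter; the final c
guarantees that there is one. -/
theorem psi_append_injective {v w : List A} (h : psi c v ++ [c] = psi c w ++ [c]) : v = w := by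
  induction v generalizing w with
  | nil =>
    cases w with
    | nil => rfl
    | cons b w =>
      by_cases hb : b = c
      · subst hb; simp at h
      · simp [psi_cons_of_ne hb] at h
  | cons a v ih =>
    cases w with
    | nil =>
      by_cases ha : a = c
      · subst ha; simp at h
      · simp [psi_cons_of_ne ha] at h
    | cons b w =>
      by_cases ha : a = c <;> by_cases hb : b = c
      · subst ha hb
        simp only [psi_cons_self, List.cons_append, List.cons.injEq, true_and] at h
        rw [ih h]
      · subst ha
        obtain ⟨t, ht⟩ := exists_psi_append_eq_cons (c := a) v
        rw [psi_cons_self, psi_cons_of_ne hb, List.cons_append, ht] at h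
        simp only [List.cons_append, List.cons.injEq, true_and] at h
        exact absurd h.1.symm hb
      · subst hb
        obtain ⟨t, ht⟩ := exists_psi_append_eq_cons (c := b) w
        rw [psi_cons_self, psi_cons_of_ne ha, List.cons_append, List.cons_append,
          List.cons_append, ht] at h
        simp only [List.cons.injEq, true_and] at h
        exact absurd h.1 ha
      · rw [psi_cons_of_ne ha, psi_cons_of_ne hb] at h
        simp only [List.cons_append, List.cons.injEq, true_and] at h
        rw [h.1, ih h.2]

theorem reverse_psi_append_eq_iff (w : List A) :
    (psi c w ++ [c]).reverse = psi c w ++ [c] ↔ w.reverse = w := by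
  rw [reverse_psi_append]
  exact ⟨psi_append_injective, fun h => by rw [h]⟩

/-! ### Palindromic closure and the morphism -/

theorem palClosure_cons_of_eq {a : A} {w : List A} (h : (a :: w).reverse = a :: w) :
    palClosure (a :: w) = a :: w := by
  rw [palClosure, if_pos h]

theorem palClosure_cons_of_ne {a : A} {w : List A} (h : (a :: w).reverse ≠ a :: w) :
    palClosure (a :: w) = a :: (palClosure w ++ [a]) := by
  rw [palClosure, if_neg h]

theorem palClosure_of_reverse_eq {w : List A} (h : w.reverse = w) : palClosure w = w := by
  cases w with
  | nil => rfl
  | cons a w => exact palClosure_cons_of_eq h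

omit [DecidableEq A] in
theorem reverse_ne_of_ne {a b : A} (h : a ≠ b) (w : List A) :
    (a :: (w ++ [b])).reverse ≠ a :: (w ++ [b]) := by
  intro e
  simp at e
  exact h e.1.symm

/-- Peeling stops at corresponding places on both sides, since palindromes correspond. The
intermediate words starting with b ≠ c end in c, so they are never palindromes. -/
theorem palClosure_psi_append (w : List A) :
    palClosure (psi c w ++ [c]) = psi c (palClosure w) ++ [c] := by
  induction w with
  | nil => simp [palClosure]
  | cons b w ih =>
    by_cases hp : (b :: w).reverse = b :: w
    · rw [palClosure_cons_of_eq hp,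
        palClosure_of_reverse_eq ((reverse_psi_append_eq_iff _).2 hp)]
    · have hn := mt (reverse_psi_append_eq_iff (c := c) (b :: w)).1 hp
      rw [palClosure_cons_of_ne hp]
      by_cases hb : b = c
      · subst hb
        rw [psi_cons_self, List.cons_append] at hn ⊢
        rw [palClosure_cons_of_ne hn, ih]
        simp
      · rw [psi_cons_of_ne hb, List.cons_append, List.cons_append] at hn ⊢
        rw [palClosure_cons_of_ne hn, palClosure_cons_of_ne (reverse_ne_of_ne hb _), ih]
        simp [psi_cons_of_ne hb]

/-- Here the image ends in x ≠ c but starts with c, so peeling can only stop inside the image of a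
letter b ≠ c, just after its c. This c is restored at the end, whence the extra c on the right. -/
theorem palClosure_psi_of_ne {x : A} (hx : x ≠ c) (w : List A) :
    palClosure (psi c (w ++ [x])) = psi c (palClosure (w ++ [x])) ++ [c] := by
  induction w with
  | nil =>
    rw [List.nil_append, palClosure_of_reverse_eq (w := [x]) rfl, psi_singleton_of_ne hx,
      palClosure_cons_of_ne (by simp [hx]), palClosure_of_reverse_eq (w := [x]) rfl]
    simp
  | cons b w ih =>
    have hpsi : psi c (w ++ [x]) = (psi c w ++ [c]) ++ [x] := by
      simp [psi_singleton_of_ne hx]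
    have key : (b :: (w ++ [x])).reverse = b :: (w ++ [x]) ↔
        (psi c (b :: (w ++ [x])) ++ [c]).reverse = psi c (b :: (w ++ [x])) ++ [c] :=
      (reverse_psi_append_eq_iff _).symm
    rw [List.cons_append]
    by_cases hb : b = c
    · subst hb
      rw [palClosure_cons_of_ne (reverse_ne_of_ne hx.symm w), psi_cons_self, hpsi,
        palClosure_cons_of_ne (reverse_ne_of_ne hx.symm _), ← hpsi, ih]
      simp
    · have hn : (c :: b :: psi c (w ++ [x])).reverse ≠ c :: b :: psi c (w ++ [x]) := by
        have := reverse_ne_of_ne hx.symm (b :: (psi c w ++ [c]))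
        rwa [List.cons_append, ← hpsi] at this
      have key2 : (b :: (w ++ [x])).reverse = b :: (w ++ [x]) ↔
          (b :: psi c (w ++ [x])).reverse = b :: psi c (w ++ [x]) := by
        rw [key, psi_cons_of_ne hb]
        generalize psi c (w ++ [x]) = s
        have e : (c :: b :: s ++ [c]).reverse = c :: ((b :: s).reverse ++ [c]) := by simp
        rw [e, List.cons_append, List.cons.injEq, and_iff_right rfl, List.append_left_inj]
      rw [psi_cons_of_ne hb, palClosure_cons_of_ne hn]
      by_cases hp : (b :: (w ++ [x])).reverse = b :: (w ++ [x])
      · rw [palClosure_cons_of_eq hp, palClosure_cons_of_eq (key2.1 hp), psi_cons_of_ne hb]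
        simp
      · rw [palClosure_cons_of_ne hp, palClosure_cons_of_ne (mt key2.2 hp), ih,
          psi_cons_of_ne hb]
        simp [psi_singleton_of_ne hb]

/-- Justin's formula. -/
theorem Pal_cons (c : A) (u : List A) : Pal (c :: u) = psi c (Pal u) ++ [c] := by
  induction u using List.reverseRecOn with
  | nil => simp [Pal, palClosure]
  | append_singleton u x ih =>
    rw [← List.cons_append, Pal_append_singleton, Pal_append_singleton, ih]
    -- The word ψ(Pal(u))cx is ψ(Pal(u)x)c if x = c, and ψ(Pal(u)x) otherwise.
    by_cases hx : x = c
    · subst hx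
      rw [← palClosure_psi_append]
      simp
    · rw [← palClosure_psi_of_ne hx]
      simp [psi_singleton_of_ne hx]

/-! ### Desubstitution -/

/-- Every occurrence of `c` in `psi c w ++ [c]` starts the image of a letter. -/
theorem psi_split {w y z : List A} (h : psi c w ++ [c] = y ++ c :: z) :
    ∃ y₀ z₀, w = y₀ ++ z₀ ∧ y = psi c y₀ ∧ c :: z = psi c z₀ ++ [c] := by
  induction w generalizing y with
  | nil =>
    cases y with
    | nil => exact ⟨[], [], rfl, rfl, h.symm⟩
    | cons b y => simp at h
  | cons a w ih =>
    cases y with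
    | nil => exact ⟨[], a :: w, rfl, rfl, h.symm⟩
    | cons b y =>
      by_cases ha : a = c
      · subst ha
        simp only [psi_cons_self, List.cons_append, List.cons.injEq] at h
        obtain ⟨y₀, z₀, h1, h2, h3⟩ := ih h.2
        exact ⟨a :: y₀, z₀, by simp [h1], by simp [h2, h.1], h3⟩
      · rw [psi_cons_of_ne ha] at h
        cases y with
        | nil =>
          simp only [List.cons_append, List.nil_append, List.cons.injEq] at h
          exact absurd h.2.1 ha
        | cons d y =>
          simp only [List.cons_append, List.cons.injEq] at h
          obtain ⟨y₀, z₀, h1, h2, h3⟩ := ih h.2.2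
          exact ⟨a :: y₀, z₀, by simp [h1], by rw [psi_cons_of_ne ha, h2, h.2.1, ← h.1], h3⟩

/-- In `psi c w ++ [c]`, one of two consecutive letters is `c`. -/
theorem eq_or_eq_of_psi {w y z : List A} {d b : A} (h : psi c w ++ [c] = y ++ d :: b :: z) :
    d = c ∨ b = c := by
  by_contra! hn
  induction w generalizing y with
  | nil =>
    have := congrArg List.length h
    simp at this
    omega
  | cons a w ih =>
    by_cases ha : a = c
    · subst ha
      cases y with
      | nil => simp at h; exact hn.1 h.1.symm
      | cons e y =>
        simp only [psi_cons_self, List.cons_append, List.cons.injEq] at h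
        exact ih h.2
    · rw [psi_cons_of_ne ha] at h
      match y with
      | [] => simp at h; exact hn.1 h.1.symm
      | [e] =>
        obtain ⟨t, ht⟩ := exists_psi_append_eq_cons (c := c) w
        simp only [List.cons_append, ht, List.nil_append, List.cons.injEq] at h
        exact hn.2 h.2.2.1.symm
      | e :: f :: y =>
        simp only [List.cons_append, List.cons.injEq] at h
        exact ih h.2.2

theorem psi_append_prefix {v w : List A} (h : v <+: w) :
    psi c v ++ [c] <+: psi c w ++ [c] := by
  obtain ⟨z, rfl⟩ := h
  obtain ⟨t, ht⟩ := exists_psi_append_eq_cons (c := c) z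
  exact ⟨t, by rw [psi_append, List.append_assoc, List.append_assoc, ht]; simp⟩

/-- A factor of `psi c w ++ [c]` that does not end in `c` is followed by `c`. -/
theorem psi_next {w y v z : List A} {a : A} (ha : a ≠ c)
    (h : psi c w ++ [c] = y ++ (v ++ [a]) ++ z) : ∃ z', z = c :: z' := by
  cases z with
  | nil =>
    exfalso
    have := congrArg List.getLast? h
    simp at this
    exact ha this.symm
  | cons b z =>
    rcases eq_or_eq_of_psi (w := w) (y := y ++ v) (z := z) (d := a) (b := b)
      (by rw [h]; simp) with h1 | rfl
    · exact absurd h1 ha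
    · exact ⟨z, rfl⟩

/-- Occurrences of `psi c v ++ [c]` in `psi c w ++ [c]` come from occurrences of `v` in `w`. -/
theorem psi_split_append {w y v z : List A}
    (h : psi c w ++ [c] = y ++ (psi c v ++ [c]) ++ z) :
    ∃ y₀ z₀, w = y₀ ++ v ++ z₀ ∧ y = psi c y₀ := by
  -- One cut is made at the first c of `psi c v ++ [c]`, another at its last c.
  obtain ⟨t, ht⟩ := exists_psi_append_eq_cons (c := c) v
  obtain ⟨y₀, z₁, h1, h2, h3⟩ := psi_split (w := w) (y := y) (z := t ++ z)
    (by rw [h, ht]; simp)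
  rw [← List.cons_append, ← ht, List.append_assoc] at h3
  obtain ⟨v₀, z₀, h4, h5, -⟩ := psi_split h3.symm
  obtain rfl := psi_append_injective (congrArg (· ++ [c]) h5)
  exact ⟨y₀, z₀, by rw [h1, h4, List.append_assoc], h2⟩

theorem infix_of_psi_append_infix {v w : List A} (h : psi c v ++ [c] <:+: psi c w ++ [c]) :
    v <:+: w := by
  obtain ⟨y, z, h⟩ := h
  obtain ⟨y₀, z₀, h1, -⟩ := psi_split_append h.symm
  exact ⟨y₀, z₀, h1.symm⟩

end Psi

/-! ### Factors of `Pal u` -/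

section PalWords

variable {A : Type*} [DecidableEq A]

theorem reverse_Pal (u : List A) : (Pal u).reverse = Pal u := by
  induction u using List.reverseRecOn with
  | nil => rfl
  | append_singleton u x _ => rw [Pal_append_singleton, reverse_palClosure]

theorem Pal_append_singleton_prefix (u : List A) (x : A) :
    Pal u ++ [x] <+: Pal (u ++ [x]) := by
  rw [Pal_append_singleton]
  exact prefix_palClosure _

theorem Pal_prefix_Pal_append (u v : List A) : Pal u <+: Pal (u ++ v) := by
  induction v using List.reverseRecOn with
  | nil => simp
  | append_singleton v x ih =>
    rw [← List.append_assoc]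
    exact (ih.trans (List.prefix_append _ _)).trans (Pal_append_singleton_prefix _ _)

theorem Pal_prefix_Pal {p u : List A} (h : p <+: u) : Pal p <+: Pal u := by
  obtain ⟨v, rfl⟩ := h
  exact Pal_prefix_Pal_append p v

omit [DecidableEq A] in
theorem suffix_of_prefix_of_reverse_eq {v w : List A} (hv : v.reverse = v) (hw : w.reverse = w)
    (h : v <+: w) : v <:+ w := by
  rw [← List.reverse_prefix, hv, hw]
  exact h

theorem Pal_suffix_Pal {p u : List A} (h : p <+: u) : Pal p <:+ Pal u :=
  suffix_of_prefix_of_reverse_eq (reverse_Pal p) (reverse_Pal u) (Pal_prefix_Pal h)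

theorem length_Pal_lt (p : List A) (a : A) (t : List A) :
    (Pal p).length < (Pal (p ++ a :: t)).length := by
  have h1 := (Pal_append_singleton_prefix p a).length_le
  have h2 := (Pal_prefix_Pal_append (p ++ [a]) t).length_le
  simp only [List.length_append, List.length_singleton, List.append_assoc,
    List.singleton_append] at h1 h2
  omega

theorem eq_of_length_Pal_eq {p q u : List A} (hp : p <+: u) (hq : q <+: u)
    (h : (Pal p).length = (Pal q).length) : p = q := by
  rcases List.prefix_or_prefix_of_prefix hp hq with ⟨t, rfl⟩ | ⟨t, rfl⟩
  · cases t with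
    | nil => simp
    | cons a t => exact absurd h (length_Pal_lt p a t).ne
  · cases t with
    | nil => simp
    | cons a t => exact absurd h (length_Pal_lt q a t).ne'

/-- The palindromic prefixes of `Pal u` are the words `Pal p`, where `p` is a prefix of `u`. -/
theorem exists_eq_Pal_of_prefix {u s : List A} (hs : s <+: Pal u) (hr : s.reverse = s) :
    ∃ p, p <+: u ∧ s = Pal p := by
  induction u generalizing s with
  | nil => exact ⟨[], List.prefix_rfl, by simpa [Pal_nil] using hs⟩
  | cons c u ih =>
    rcases List.eq_nil_or_concat s with rfl | ⟨v, b, rfl⟩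
    · exact ⟨[], List.nil_prefix, rfl⟩
    · rw [Pal_cons, List.concat_eq_append] at *
      obtain ⟨z, hz⟩ := hs
      -- A palindrome ends in its first letter, here the first letter c of the whole word.
      have hb : b = c := by
        obtain ⟨t, ht⟩ := exists_psi_append_eq_cons (c := c) (Pal u)
        rw [ht, ← hr] at hz
        simp at hz
        exact hz.1
      subst hb
      rw [List.append_assoc] at hz
      obtain ⟨y₀, z₀, h1, rfl, -⟩ := psi_split hz.symm
      obtain ⟨p, hp, rfl⟩ := ih ⟨z₀, h1.symm⟩ ((reverse_psi_append_eq_iff y₀).1 hr)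
      exact ⟨b :: p, List.cons_prefix_cons.2 ⟨rfl, hp⟩, (Pal_cons b p).symm⟩

/-- The image of a letter e ends in e, so the letter in front of an image is the preceding letter of
the preimage. -/
theorem cons_infix_of_psi {c d : A} {v w : List A} (h : d :: (psi c v ++ [c]) <:+: psi c w ++ [c]) :
    d :: v <:+: w := by
  obtain ⟨y, z, h⟩ := h
  obtain ⟨y₀, z₀, h1, h2⟩ := psi_split_append (w := w) (y := y ++ [d]) (v := v) (z := z)
    (by rw [← h]; simp)
  rcases List.eq_nil_or_concat y₀ with rfl | ⟨y₁, e, rfl⟩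
  · simp at h2
  · have he : d = e := by
      by_cases hc : e = c
      · subst hc
        have := congrArg List.getLast? h2
        simpa [psi_cons_self] using this
      · have := congrArg List.getLast? h2
        simpa [psi_singleton_of_ne hc] using this
    subst he
    exact ⟨y₁, z₀, by rw [h1]; simp⟩

/-- The left special factors of `Pal u` are prefixes of `Pal u`. -/
theorem prefix_Pal_of_left_special {u v : List A} {d e : A} (hde : d ≠ e)
    (hd : d :: v <:+: Pal u) (he : e :: v <:+: Pal u) : v <+: Pal u := by
  induction u generalizing v with
  | nil => simp [Pal_nil] at hd
  | cons c u ih =>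
    rw [Pal_cons] at *
    -- It suffices to treat words ending in c: any other last letter is followed by c in both
    -- occurrences.
    suffices H : ∀ t, d :: (t ++ [c]) <:+: psi c (Pal u) ++ [c] →
        e :: (t ++ [c]) <:+: psi c (Pal u) ++ [c] → t ++ [c] <+: psi c (Pal u) ++ [c] by
      rcases List.eq_nil_or_concat v with rfl | ⟨t, b, rfl⟩
      · exact List.nil_prefix
      · rw [List.concat_eq_append] at *
        by_cases hb : b = c
        · subst hb; exact H t hd he
        · obtain ⟨y, z, hd⟩ := hd
          obtain ⟨y', z', he⟩ := he
          obtain ⟨z, rfl⟩ := psi_next (v := d :: t) hb hd.symm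
          obtain ⟨z', rfl⟩ := psi_next (v := e :: t) hb he.symm
          exact (List.prefix_append _ [c]).trans
            (H (t ++ [b]) ⟨y, z, by rw [← hd]; simp⟩ ⟨y', z', by rw [← he]; simp⟩)
    intro t hd he
    -- A first letter other than c could only be preceded by c, against d ≠ e.
    obtain ⟨r, hr⟩ : ∃ r, t ++ [c] = c :: r := by
      cases t with
      | nil => exact ⟨[], rfl⟩
      | cons b t =>
        by_cases hb : b = c
        · subst hb; exact ⟨_, rfl⟩
        · obtain ⟨y, z, hd⟩ := hd
          obtain ⟨y', z', he⟩ := he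
          rcases eq_or_eq_of_psi (y := y) (d := d) (b := b) (z := t ++ c :: z)
            (by rw [← hd]; simp) with h1 | h1
          · rcases eq_or_eq_of_psi (y := y') (d := e) (b := b) (z := t ++ c :: z')
              (by rw [← he]; simp) with h2 | h2
            · exact absurd (h1.trans h2.symm) hde
            · exact absurd h2 hb
          · exact absurd h1 hb
    obtain ⟨v₀, rfl⟩ : ∃ v₀, t = psi c v₀ := by
      obtain ⟨y, z, hd⟩ := hd
      obtain ⟨y₀, z₀, -, -, h3⟩ := psi_split (w := Pal u) (c := c) (y := y ++ [d]) (z := r ++ z)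
        (by rw [← hd, hr]; simp)
      rw [← List.cons_append, ← hr, List.append_assoc] at h3
      obtain ⟨v₀, -, -, h5, -⟩ := psi_split h3.symm
      exact ⟨v₀, h5⟩
    exact psi_append_prefix (ih (cons_infix_of_psi hd) (cons_infix_of_psi he))

theorem mem_of_mem_Pal {u : List A} {a : A} (h : a ∈ Pal u) : a ∈ u := by
  induction u with
  | nil => simp [Pal_nil] at h
  | cons c u ih =>
    rw [Pal_cons] at h
    simp only [List.mem_append, psi, List.mem_flatMap, List.mem_singleton] at h
    rcases h with ⟨b, hb, h⟩ | rfl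
    · split at h
      · simp at h; simp [h]
      · simp at h
        rcases h with rfl | rfl
        · simp
        · exact List.mem_cons_of_mem _ (ih hb)
    · simp

/-- Each letter of p is removed by desubstitution, until a occurs in Pal(v). -/
theorem mem_of_Pal_append_infix {p v : List A} {a : A} (h : Pal p ++ [a] <:+: Pal (p ++ v)) :
    a ∈ v := by
  induction p with
  | nil => exact mem_of_mem_Pal (h.subset (by simp))
  | cons c p ih =>
    rw [List.cons_append, Pal_cons, Pal_cons] at h
    refine ih (infix_of_psi_append_infix (c := c) ?_)
    by_cases ha : a = c
    · subst ha
      simpa using h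
    · obtain ⟨y, z, h⟩ := h
      obtain ⟨z, rfl⟩ := psi_next ha h.symm
      exact ⟨y, z, by rw [← h]; simp [psi_singleton_of_ne ha]⟩

end PalWords

/-! ### Residuals of the language of suffixes of `Pal u` -/

section Residuals

variable {A : Type*}

theorem mem_leftQuotient_suffixLanguage {w v s : List A} :
    s ∈ (suffixLanguage w).leftQuotient v ↔ v ++ s <:+ w := Iff.rfl

theorem leftQuotient_append_congr {L : Language A} {y z : List A}
    (h : L.leftQuotient y = L.leftQuotient z) (s : List A) :
    L.leftQuotient (y ++ s) = L.leftQuotient (z ++ s) := by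
  rw [Language.leftQuotient_append, Language.leftQuotient_append, h]

theorem infix_iff_exists_mem_leftQuotient {w v : List A} :
    v <:+: w ↔ ∃ s, s ∈ (suffixLanguage w).leftQuotient v := by
  constructor
  · rintro ⟨y, s, h⟩
    exact ⟨s, y, by rw [← h, List.append_assoc]⟩
  · rintro ⟨s, hs⟩
    exact (List.prefix_append v s).isInfix.trans hs.isInfix

theorem infix_congr {w v z : List A}
    (h : (suffixLanguage w).leftQuotient v = (suffixLanguage w).leftQuotient z)
    (hv : v <:+: w) : z <:+: w := by
  rw [infix_iff_exists_mem_leftQuotient] at *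
  rwa [← h]

/-- The residual of a prefix v contains the rest of w, which leaves room for at most |v| letters
before it. -/
theorem length_le_of_leftQuotient_eq {w v z : List A} (hv : v <+: w)
    (h : (suffixLanguage w).leftQuotient v = (suffixLanguage w).leftQuotient z) :
    z.length ≤ v.length := by
  obtain ⟨s, rfl⟩ := hv
  have h1 : s ∈ (suffixLanguage (v ++ s)).leftQuotient v := List.suffix_rfl
  rw [h] at h1
  have h2 := List.IsSuffix.length_le h1
  simp only [List.length_append] at h2
  omega

theorem eq_of_leftQuotient_eq {w v z : List A} (hv : v <+: w) (hz : z <+: w)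
    (h : (suffixLanguage w).leftQuotient v = (suffixLanguage w).leftQuotient z) : v = z := by
  have h1 := length_le_of_leftQuotient_eq hv h
  have h2 := length_le_of_leftQuotient_eq hz h.symm
  exact (List.prefix_of_prefix_length_le hv hz h2).eq_of_length (by omega)

/-- A word with two continuations in `w` has a special residual. -/
theorem isSpecialResidual_of_branching {w v : List A} {a b : A} (hab : a ≠ b)
    (ha : v ++ [a] <:+: w) (hb : v ++ [b] <:+: w) :
    IsSpecialResidual (suffixLanguage w) ((suffixLanguage w).leftQuotient v) := by
  rw [infix_iff_exists_mem_leftQuotient] at ha hb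
  obtain ⟨s, hs⟩ := ha
  obtain ⟨t, ht⟩ := hb
  rw [mem_leftQuotient_suffixLanguage, List.append_assoc] at hs ht
  exact ⟨⟨_, hs⟩, v, rfl, Or.inr (Or.inr ⟨a, b, s, t, hab, hs, ht⟩)⟩

variable [DecidableEq A]

/-- Every factor of `Pal u` can be extended on the left to a prefix of `Pal u` without changing
its residual. -/
theorem exists_prefix_leftQuotient_eq {u v : List A} (hv : v <:+: Pal u) :
    ∃ y, y ++ v <+: Pal u ∧ (suffixLanguage (Pal u)).leftQuotient (y ++ v) =
      (suffixLanguage (Pal u)).leftQuotient v := by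
  obtain ⟨n, hn⟩ : ∃ n, (Pal u).length - v.length = n := ⟨_, rfl⟩
  induction n using Nat.strong_induction_on generalizing v with
  | _ n ih =>
    by_cases hp : v <+: Pal u
    · exact ⟨[], hp, rfl⟩
    have left : ∀ y z : List A, y ++ (v ++ z) = Pal u → ∃ y' d, y = y' ++ [d] := by
      intro y z h
      rcases List.eq_nil_or_concat y with rfl | ⟨y', d, rfl⟩
      · exact absurd ⟨z, h⟩ hp
      · exact ⟨y', d, List.concat_eq_append⟩
    obtain ⟨y, z, h⟩ := hv
    obtain ⟨y, d, rfl⟩ := left y z (by rw [← h, List.append_assoc])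
    have hd : d :: v <:+: Pal u := ⟨y, z, by rw [← h]; simp⟩
    -- Every occurrence of v is preceded by d: two different letters would make v left special,
    -- hence a prefix.
    have hq : (suffixLanguage (Pal u)).leftQuotient (d :: v) =
        (suffixLanguage (Pal u)).leftQuotient v := by
      ext s
      constructor
      · exact fun hs => (List.suffix_cons d (v ++ s)).trans hs
      · rintro ⟨y', h'⟩
        obtain ⟨y', e, rfl⟩ := left y' s h'
        have he : e :: v <:+: Pal u := ⟨y', s, by rw [← h']; simp⟩
        by_cases hde : d = e
        · subst hde
          exact ⟨y', by rw [← h']; simp⟩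
        · exact absurd (prefix_Pal_of_left_special hde hd he) hp
    have hl := hd.length_le
    rw [List.length_cons] at hl
    obtain ⟨t, ht1, ht2⟩ := ih _ (by rw [← hn, List.length_cons]; omega) hd rfl
    exact ⟨t ++ [d], by simpa using ht1, by simpa using ht2.trans hq⟩

/-- The special residuals are the residuals of the words `Pal p`, where `p` is a prefix of `u`. -/
theorem isSpecialResidual_iff {u : List A} {R : Language A} :
    IsSpecialResidual (suffixLanguage (Pal u)) R ↔ ∃ p, p <+: u ∧ prefixToState u p = R := by
  constructor
  · rintro ⟨hne, v, rfl, h⟩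
    rcases h with rfl | h
    · exact ⟨[], List.nil_prefix, rfl⟩
    obtain ⟨y, hy1, hy2⟩ := exists_prefix_leftQuotient_eq (infix_iff_exists_mem_leftQuotient.2 hne)
    suffices hr : (y ++ v).reverse <+: Pal u by
      have hr' : (y ++ v).reverse = y ++ v :=
        (List.prefix_of_prefix_length_le hr hy1 List.length_reverse.le).eq_of_length
          List.length_reverse
      obtain ⟨p, hp, he⟩ := exists_eq_Pal_of_prefix hy1 hr'
      exact ⟨p, hp, by rw [prefixToState, ← he, hy2]⟩
    -- The reversal is a prefix because yv is a suffix in the terminal case, and because it is left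
    -- special in the branching case.
    rcases h with h | ⟨a, b, s, t, hab, ha, hb⟩
    · have h1 : ([] : List A) ∈ (suffixLanguage (Pal u)).leftQuotient v := by
        rw [mem_leftQuotient_suffixLanguage, List.append_nil]
        exact h
      rw [← hy2, mem_leftQuotient_suffixLanguage, List.append_nil] at h1
      rwa [← List.reverse_suffix, List.reverse_reverse, reverse_Pal]
    · rw [← hy2, mem_leftQuotient_suffixLanguage] at ha hb
      have key : ∀ (c : A) (r : List A), y ++ v ++ c :: r <:+ Pal u →
          c :: (y ++ v).reverse <:+: Pal u := by
        intro c r hc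
        have h1 : y ++ v ++ [c] <:+: Pal u :=
          List.IsInfix.trans ⟨[], r, by simp⟩ hc.isInfix
        rw [← List.reverse_infix, reverse_Pal] at h1
        simpa using h1
      exact prefix_Pal_of_left_special hab (key a s ha) (key b t hb)
  · rintro ⟨p, hp, rfl⟩
    have hs := Pal_suffix_Pal hp
    refine ⟨⟨[], ?_⟩, Pal p, rfl, Or.inr (Or.inl hs)⟩
    rw [prefixToState, mem_leftQuotient_suffixLanguage, List.append_nil]
    exact hs

theorem prefixToState_injOn {u p q : List A} (hp : p <+: u) (hq : q <+: u)
    (h : prefixToState u p = prefixToState u q) : p = q :=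
  eq_of_length_Pal_eq hp hq
    (congrArg List.length (eq_of_leftQuotient_eq (Pal_prefix_Pal hp) (Pal_prefix_Pal hq) h))

/-! ### Edges of the compact suffix automaton -/

/-- If the letter `a` does not occur in `t`, then the factors `Pal p ++ [a]` of `Pal u` are the
suffixes of the factors `Pal (p ++ t) ++ [a]`. -/
theorem leftQuotient_Pal_append {u p t : List A} {a : A} (hpt : p ++ t ++ [a] <+: u)
    (ha : a ∉ t) (s : List A) :
    (suffixLanguage (Pal u)).leftQuotient (Pal p ++ a :: s) =
      (suffixLanguage (Pal u)).leftQuotient (Pal (p ++ t) ++ a :: s) := by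
  have h1 : Pal (p ++ t) ++ [a] <+: Pal u :=
    (Pal_append_singleton_prefix _ _).trans (Pal_prefix_Pal hpt)
  obtain ⟨z, hz⟩ := h1
  obtain ⟨r, hr⟩ := Pal_suffix_Pal (List.prefix_append p t)
  have h2 : Pal p ++ [a] ++ z <:+ Pal u := ⟨r, by rw [← hz, ← hr]; simp⟩
  obtain ⟨y, hy1, hy2⟩ := exists_prefix_leftQuotient_eq
    ((List.prefix_append _ z).isInfix.trans h2.isInfix)
  have h3 : y ++ (Pal p ++ [a]) ++ z <:+ Pal u := by
    rw [← mem_leftQuotient_suffixLanguage, hy2]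
    exact h2
  have h4 := h3.length_le
  rw [← hz] at h4
  -- By length, the extension is a prefix of Pal(pt)a. A proper one would put Pal(p)a inside
  -- Pal(pt), forcing a ∈ t.
  have h5 : y ++ (Pal p ++ [a]) = Pal (p ++ t) ++ [a] := by
    have hpre : y ++ (Pal p ++ [a]) <+: Pal (p ++ t) ++ [a] :=
      List.prefix_of_prefix_length_le hy1 ⟨z, hz⟩
        (by simp only [List.length_append] at h4 ⊢; omega)
    rcases List.prefix_concat_iff.1 hpre with h | h
    · exact h
    · exact absurd (mem_of_Pal_append_infix
        ((List.suffix_append y _).isInfix.trans h.isInfix)) ha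
  have h6 := leftQuotient_append_congr hy2 s
  rw [h5] at h6
  simpa using h6.symm

/-- The word `Pal(q)⁻¹ Pal(qa)` starts with `a`. -/
theorem exists_wordQuotient_eq_cons (q : List A) (a : A) :
    ∃ s, wordQuotient (Pal q) (Pal (q ++ [a])) = a :: s := by
  obtain ⟨s, hs⟩ := Pal_append_singleton_prefix q a
  exact ⟨s, by rw [← hs]; simp [wordQuotient]⟩

/-- Reading `Pal(pt)⁻¹ Pal(pta)` from the state `p`, where `a` does not occur in `t`, one
reaches the state `pta`. -/
theorem leftQuotient_Pal_append_wordQuotient {u p t : List A} {a : A}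
    (hpt : p ++ t ++ [a] <+: u) (ha : a ∉ t) :
    (suffixLanguage (Pal u)).leftQuotient
      (Pal p ++ wordQuotient (Pal (p ++ t)) (Pal (p ++ t ++ [a]))) =
      prefixToState u (p ++ t ++ [a]) := by
  obtain ⟨s, hs⟩ := exists_wordQuotient_eq_cons (p ++ t) a
  rw [hs, leftQuotient_Pal_append hpt ha, ← hs, (Pal_append_wordQuotient (p ++ t) a).1]
  rfl

/-- No state is met before the end of this path. -/
theorem eq_wordQuotient_of_isSpecialResidual {u p t v : List A} {a : A}
    (hpt : p ++ t ++ [a] <+: u) (ha : a ∉ t) (hv : v ≠ [])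
    (hpre : v <+: wordQuotient (Pal (p ++ t)) (Pal (p ++ t ++ [a])))
    (hsp : IsSpecialResidual (suffixLanguage (Pal u))
      ((suffixLanguage (Pal u)).leftQuotient (Pal p ++ v))) :
    v = wordQuotient (Pal (p ++ t)) (Pal (p ++ t ++ [a])) := by
  have hw := (Pal_append_wordQuotient (p ++ t) a).1
  obtain ⟨s, hs⟩ := exists_wordQuotient_eq_cons (p ++ t) a
  generalize wordQuotient (Pal (p ++ t)) (Pal (p ++ t ++ [a])) = w at *
  subst hs
  obtain ⟨b, v, rfl⟩ := List.exists_cons_of_ne_nil hv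
  obtain ⟨rfl, -⟩ := List.cons_prefix_cons.1 hpre
  rw [leftQuotient_Pal_append hpt ha] at hsp
  obtain ⟨r, hr, he⟩ := isSpecialResidual_iff.1 hsp
  have h1 : Pal (p ++ t) ++ b :: v <+: Pal (p ++ t ++ [b]) := by
    rw [← hw]
    exact (List.prefix_append_right_inj _).2 hpre
  have h2 : Pal r = Pal (p ++ t) ++ b :: v :=
    eq_of_leftQuotient_eq (Pal_prefix_Pal hr) (h1.trans (Pal_prefix_Pal hpt)) he
  -- The length of Pal(r) exceeds that of Pal(pt) and is at most that of Pal(ptb).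
  have h3 : r = p ++ t ++ [b] := by
    rcases List.prefix_or_prefix_of_prefix hr hpt with h | ⟨m, rfl⟩
    · rcases List.prefix_concat_iff.1 h with h | h
      · exact h
      · have := (Pal_prefix_Pal h).length_le
        rw [h2] at this
        simp at this
    · cases m with
      | nil => simp
      | cons c m =>
        have h4 := length_Pal_lt (p ++ t ++ [b]) c m
        have h5 := h1.length_le
        rw [← h2] at h5
        omega
  rw [h3, ← hw] at h2
  exact (List.append_cancel_left h2).symm

/-- Two words are comparable for the prefix order, or they branch. -/
theorem prefix_or_branching (v w : List A) :
    v <+: w ∨ w <+: v ∨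
      ∃ (c : List A) (a b : A), a ≠ b ∧ c ++ [a] <+: v ∧ c ++ [b] <+: w := by
  induction v generalizing w with
  | nil => exact Or.inl List.nil_prefix
  | cons a v ih =>
    cases w with
    | nil => exact Or.inr (Or.inl List.nil_prefix)
    | cons b w =>
      by_cases hab : a = b
      · subst hab
        rcases ih w with h | h | ⟨c, d, e, h1, h2, h3⟩
        · exact Or.inl (List.cons_prefix_cons.2 ⟨rfl, h⟩)
        · exact Or.inr (Or.inl (List.cons_prefix_cons.2 ⟨rfl, h⟩))
        · exact Or.inr (Or.inr ⟨a :: c, d, e, h1, List.cons_prefix_cons.2 ⟨rfl, h2⟩,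
            List.cons_prefix_cons.2 ⟨rfl, h3⟩⟩)
      · exact Or.inr (Or.inr ⟨[], a, b, hab, ⟨v, rfl⟩, ⟨w, rfl⟩⟩)

/-- The edges of the compact suffix automaton of `Pal u`. -/
theorem mem_edges_prefixSuffixAutomaton {u p r v : List A} :
    (p, v, r) ∈ (prefixSuffixAutomaton u).edges ↔
      r <+: u ∧ ∃ t a, a ∉ t ∧ r = p ++ t ++ [a] ∧ v = wordQuotient (Pal (p ++ t)) (Pal r) := by
  constructor
  · rintro ⟨hp, hr, -, hv, -, z, hz1, hz2, hz3⟩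
    simp only [Set.mem_ofPred_eq] at hp hr hv hz1 hz2 hz3
    have hz : ∀ s, (suffixLanguage (Pal u)).leftQuotient (z ++ s) =
        (suffixLanguage (Pal u)).leftQuotient (Pal p ++ s) :=
      fun s => leftQuotient_append_congr hz1.symm s
    simp only [hz] at hz2 hz3
    have hinf : Pal p ++ v <:+: Pal u := infix_congr hz2 (Pal_prefix_Pal hr).isInfix
    obtain ⟨a, v, rfl⟩ := List.exists_cons_of_ne_nil hv
    obtain ⟨m, rfl⟩ := hp
    have hmem : a ∈ m := mem_of_Pal_append_infix (List.IsInfix.trans ⟨[], v, by simp⟩ hinf)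
    -- The word t stops before the first a in m.
    obtain ⟨t, t', rfl, ha⟩ := List.eq_append_cons_of_mem hmem
    have hpt : p ++ t ++ [a] <+: p ++ (t ++ a :: t') := ⟨t', by simp⟩
    have hw := leftQuotient_Pal_append_wordQuotient hpt ha
    have hspw : IsSpecialResidual (suffixLanguage (Pal (p ++ (t ++ a :: t'))))
        (prefixToState (p ++ (t ++ a :: t')) (p ++ t ++ [a])) :=
      isSpecialResidual_iff.2 ⟨_, hpt, rfl⟩
    have hinfw := infix_congr hw.symm (Pal_prefix_Pal hpt).isInfix
    have heq : a :: v = wordQuotient (Pal (p ++ t)) (Pal (p ++ t ++ [a])) := by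
      -- A label extending the expected word properly would pass through the state pta; one
      -- diverging from it would pass through the branching state.
      rcases prefix_or_branching (a :: v) (wordQuotient (Pal (p ++ t)) (Pal (p ++ t ++ [a])))
        with h | ⟨s, h⟩ | ⟨c, b, d, hbd, hb, hd⟩
      · exact eq_wordQuotient_of_isSpecialResidual hpt ha hv h
          (isSpecialResidual_iff.2 ⟨r, hr, hz2⟩)
      · by_cases hs : s = []
        · subst hs
          rw [← h, List.append_nil]
        · exact absurd ⟨_, s, h.symm, (Pal_append_wordQuotient _ _).2, hs, by rwa [hw]⟩ hz3
      · exfalso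
        have hc : c ≠ [] := by
          rintro rfl
          obtain ⟨s, hs⟩ := exists_wordQuotient_eq_cons (p ++ t) a
          rw [hs] at hd
          rw [List.nil_append, List.cons_prefix_cons] at hb hd
          exact hbd (hb.1.trans hd.1.symm)
        have key : ∀ (e : A) (x : List A), c ++ [e] <+: x →
            Pal p ++ x <:+: Pal (p ++ (t ++ a :: t')) →
            Pal p ++ c ++ [e] <:+: Pal (p ++ (t ++ a :: t')) := by
          intro e x he hx
          rw [List.append_assoc]
          exact ((List.prefix_append_right_inj _).2 he).isInfix.trans hx
        obtain ⟨s, hs⟩ := hb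
        exact hz3 ⟨c, b :: s, by rw [← hs]; simp, hc, by simp,
          isSpecialResidual_of_branching hbd (key b _ ⟨s, hs⟩ hinf) (key d _ hd hinfw)⟩
    have hrr : r = p ++ t ++ [a] := by
      refine prefixToState_injOn hr hpt (Eq.trans ?_ hw)
      rw [← heq]
      exact hz2
    exact ⟨hr, t, a, ha, hrr, by rw [heq, hrr]⟩
  · rintro ⟨hr, t, a, ha, rfl, rfl⟩
    have hp : p <+: u := List.IsPrefix.trans ⟨t ++ [a], by simp⟩ hr
    refine ⟨hp, hr, isSpecialResidual_iff.2 ⟨p, hp, rfl⟩, (Pal_append_wordQuotient _ _).2,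
      isSpecialResidual_iff.2 ⟨_, hr, rfl⟩, Pal p, rfl,
      (leftQuotient_Pal_append_wordQuotient hr ha).symm, ?_⟩
    rintro ⟨v₁, v₂, h, h1, h2, h3⟩
    change wordQuotient (Pal (p ++ t)) (Pal (p ++ t ++ [a])) = v₁ ++ v₂ at h
    have h4 := eq_wordQuotient_of_isSpecialResidual hr ha h1 ⟨v₂, h.symm⟩ h3
    rw [h] at h4
    exact h2 (List.append_right_eq_self.1 h4.symm)

theorem mem_terminal_prefixSuffixAutomaton {u p : List A} :
    p ∈ (prefixSuffixAutomaton u).terminal ↔ p <+: u := by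
  constructor
  · exact fun h => h.1
  · exact fun h => ⟨h, isSpecialResidual_iff.2 ⟨p, h, rfl⟩, Pal p, Pal_suffix_Pal h, rfl⟩

theorem mem_initial_prefixSuffixAutomaton {u p : List A} :
    p ∈ (prefixSuffixAutomaton u).initial ↔ p = [] := by
  constructor
  · exact fun h => prefixToState_injOn h.1 List.nil_prefix h.2.2
  · rintro rfl
    exact ⟨List.nil_prefix, isSpecialResidual_iff.2 ⟨[], List.nil_prefix, rfl⟩, rfl⟩

/-- The prefixes of `u` name the states of the compact suffix automaton of `Pal u`. -/
theorem prefixSuffixAutomaton_isIso (u : List A) :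
    (prefixSuffixAutomaton u).IsIso (prefixToState u) (compactSuffixAutomaton u) := by
  refine ⟨⟨fun p hp => isSpecialResidual_iff.2 ⟨p, hp, rfl⟩,
    fun p hp q hq h => prefixToState_injOn hp hq h,
    fun R hR => isSpecialResidual_iff.1 hR⟩, ?_, ?_, ?_⟩
  · exact fun p hp q hq v => ⟨fun h => h.2.2, fun h => ⟨hp, hq, h⟩⟩
  · exact fun p hp => ⟨fun h => h.2, fun h => ⟨hp, h⟩⟩
  · exact fun p hp => ⟨fun h => h.2, fun h => ⟨hp, h⟩⟩

end Residuals

theorem mainTheorem5 {A : Type*} [DecidableEq A] (u : List A) (x : A) (h u₂ : List A)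
    (hu : u = h ++ u₂) (hfree : x ∉ u₂)
    (hlongest : ∀ s : List A, s <:+ u → x ∉ s → s.length ≤ u₂.length) :
    (prefixSuffixAutomaton u).IsIso (prefixToState u) (compactSuffixAutomaton u) ∧
    (prefixSuffixAutomaton (u ++ [x])).IsIso (prefixToState (u ++ [x]))
      (compactSuffixAutomaton (u ++ [x])) ∧
    extendedAutomaton u x h u₂ hu = prefixSuffixAutomaton (u ++ [x]) := by
  refine ⟨prefixSuffixAutomaton_isIso u, prefixSuffixAutomaton_isIso (u ++ [x]), ?_⟩
  have hstates : ∀ p, p <+: u ++ [x] ↔ p <+: u ∨ p = u ++ [x] := fun p => by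
    rw [List.prefix_concat_iff, or_comm]
  ext e
  · exact (hstates e).symm
  · obtain ⟨p, v, r⟩ := e
    rw [mem_edges_prefixSuffixAutomaton, hstates]
    change (p, v, r) ∈ (prefixSuffixAutomaton u).edges ∨ (∃ q, q <+: u₂ ∧ _) ↔ _
    rw [mem_edges_prefixSuffixAutomaton, or_and_right]
    refine or_congr Iff.rfl ⟨?_, ?_⟩
    · rintro ⟨q, ⟨t, rfl⟩, he⟩
      simp only [Prod.mk.injEq] at he
      obtain ⟨rfl, rfl, rfl⟩ := he
      exact ⟨rfl, t, x, fun hx => hfree (List.mem_append_right _ hx), by simp [hu],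
        by rw [hu]; simp⟩
    · rintro ⟨rfl, t, a, ha, hr, rfl⟩
      obtain ⟨he, hxa⟩ := List.append_inj' hr rfl
      obtain rfl : x = a := by simpa using hxa
      -- Maximality of u₂ makes t no longer than u₂, so p extends h.
      have hlen := hlongest t ⟨p, he.symm⟩ ha
      obtain ⟨q, hq⟩ : h <+: p := by
        refine List.prefix_of_prefix_length_le ⟨u₂, hu.symm⟩ ⟨t, he.symm⟩ ?_
        have := congrArg List.length (hu.symm.trans he)
        simp only [List.length_append] at this
        omega
      subst hq
      refine ⟨q, ⟨t, ?_⟩, by rw [← he]⟩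
      rw [hu, List.append_assoc] at he
      exact (List.append_cancel_left he).symm
  · rw [mem_initial_prefixSuffixAutomaton]
    exact mem_initial_prefixSuffixAutomaton
  · rw [mem_terminal_prefixSuffixAutomaton, hstates]
    exact or_congr mem_terminal_prefixSuffixAutomaton Iff.rfl
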